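/- **Operators.** Let $\mathcal A$ be a commutative Hausdorff topological $\mathbb Q$-algebra with a derivation $D$. A formal operator is a series $A=\sum_{i\in\mathbb Z}f_iD^i$, $f_i\in\mathcal A$; put $A_+=\sum_{i\ge0}f_iD^i$, $A_-=\sum_{i<0}f_iD^i$, $A^*=\sum_i(-D)^i f_i$; products follow $D^i f=\sum_{r\ge0}\binom ir D^r(f)D^{i-r}$. A *ring of operators* is an additive group of formal operators, containing all $D^i$ and stable under $A\mapsto A_\pm$, on which all products converge coefficientwise (as unconditional sums in $\mathcal A$), stay in the group, and are associative. Fix two rings of operators $\mathcal D^-$ and $\mathcal D^+$ with $(\mathcal D^-)_+\subset\mathcal D^+$ and $(\mathcal D^+)_-\subset\mathcal D^-$. Let $t_k,\hat t_k\in\mathcal A$ ($k$ odd positive), $t_1=x$, be the time variables, with pairwise commuting derivations $\partial_{t_k},\partial_{\hat t_k}$ of $\mathcal A$ for which the times are independent coordinates, and $\partial_{t_1}=D$. Derivations of $\mathcal A$ act on operators coefficientwise. **Hierarchy.** Let $n\ge2$. Let $\Phi=1+\sum_{i\ge1}a_iD^{-i}$ be invertible in $\mathcal D^-$ and $\hat\Phi=1+\sum_{i\ge1}b_iD^i$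 be invertible in $\mathcal D^+$, with $\Phi^*=D\Phi^{-1}D^{-1}$ and $\hat\Phi^*=D\hat\Phi^{-1}D^{-1}$. Put $L=\Phi D\Phi^{-1}$, $\hat L=\hat\Phi D^{-1}\hat\Phi^{-1}$. Suppose that they solve the D-type Drinfeld–Sokolov hierarchy, that is, the two-component BKP hierarchy $$\partial_{t_k}\Phi=-(L^k)_-\Phi,\quad \partial_{t_k}\hat\Phi=\bigl((L^k)_+-\delta_{k1}\hat L^{-1}\bigr)\hat\Phi,\quad \partial_{\hat t_k}\Phi=-(\hat L^k)_-\Phi,\quad \partial_{\hat t_k}\hat\Phi=(\hat L^k)_+\hat\Phi\qquad(k\text{ odd positive})$$ with the reduction $\mathcal L:=L^{2n}=\hat L^2$. Assume that $$\Gamma_L=\sum_{k\text{ odd}>0}\tfrac{k}{2n}t_kD^{k-2n}\in\mathcal D^-,\qquad \hat\Gamma_R=-\tfrac x2D^3-\tfrac12\sum_{k\text{ odd}>0}k\hat t_kD^{2-k}\in\mathcal D^+,$$ and put $\mathcal M=\Phi\Gamma_L\Phi^{-1}$, $\hat{\mathcal M}=\hat\Phi\hat\Gamma_R\hat\Phi^{-1}$,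 and $\mathcal B_{m,l}=(\mathcal M-\hat{\mathcal M})^m\mathcal L^l$ for $m$ odd positive and $l\ge0$. **Additional flows.** The flow $\partial_{c_{m,l}}$ is a continuous derivation of $\mathcal A$ that commutes with $D$, annihilates all times, preserves $\mathcal D^\pm$, and satisfies $$\partial_{c_{m,l}}\Phi=-(\mathcal B_{m,l})_-\Phi,\qquad \partial_{c_{m,l}}\hat\Phi=(\mathcal B_{m,l})_+\hat\Phi .$$ **Theorem.** Let $m,s$ be odd positive integers and $k,l\ge0$. If $(m,s)\neq(1,1)$, assume that the products mixing $\mathcal M$ and $\hat{\mathcal M}$ are defined, i.e. $\mathcal L,\mathcal M,\hat{\mathcal M}$ lie in a common ring of operators $R$ with $R_-\subset\mathcal D^-$ and $R_+\subset\mathcal D^+$ (for $m=s=1$ no such assumption is made). Let $\partial_{c_{m,l}}$, $\partial_{c_{s,k}}$ and (if $k+l\ge1$) $\partial_{c_{m+s-1,k+l-1}}$ be the corresponding flows. Then $\partial_{c_{m,l}}\mathcal L=[-(\mathcal B_{m,l})_-,\mathcal L]$, and the Block algebra relation $$[\partial_{c_{m,l}},\partial_{c_{s,k}}]=(km-sl)\,\partial_{c_{m+s-1,k+l-1}}$$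 holds when acting on $\Phi$, on $\hat\Phi$ and on $\mathcal L$ (for $k=l=0$ the right-hand side is $0$). -/

import Mathlib

noncomputable section

namespace DrinfeldSokolov

/-- Formal operators `∑_{i ∈ ℤ} f_i D^i`, given by their coefficients (written on the left). -/
abbrev Op (A : Type*) : Type _ := ℤ → A

section Operators

variable {A : Type*} [CommRing A] [Algebra ℚ A]

/-- The operator `D^i`. -/
def dpow (A : Type*) [CommRing A] (i : ℤ) : Op A := Pi.single i 1

/-- The nonnegative projection `A_+`. -/
def pos (P : Op A) : Op A := fun i => if 0 ≤ i then P i else 0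

/-- The negative projection `A_-`. -/
def neg (P : Op A) : Op A := fun i => if i < 0 then P i else 0

/-- A derivation of the coefficients acts on operators coefficientwise. -/
def act (δ : Derivation ℚ A A) (P : Op A) : Op A := fun i => δ (P i)

/-- The contributions to the coefficient of `D^k` in the product of `P = ∑ f_i D^i` and
`Q = ∑ g_j D^j`, by `D^i · g = ∑_{r ≥ 0} binom(i, r) D^r(g) D^{i-r}`: the pair `(i, r)` contributes
`binom(i, r) f_i D^r(g_j)` with `i + j - r = k`. -/
def leibnizTerm (D : Derivation ℚ A A) (P Q : Op A) (k : ℤ) (p : ℤ × ℕ) : A :=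
  Ring.choose p.1 p.2 • (P p.1 * (⇑D)^[p.2] (Q (k - p.1 + p.2)))

variable [TopologicalSpace A]

/-- The product of two operators (meaningful where the sums converge). -/
def mul (D : Derivation ℚ A A) (P Q : Op A) : Op A := fun k => ∑' p, leibnizTerm D P Q k p

/-- Powers of an operator. -/
def pow (D : Derivation ℚ A A) (P : Op A) : ℕ → Op A
  | 0 => dpow A 0
  | j + 1 => mul D (pow D P j) P

/-- The commutator of two operators. -/
def comm (D : Derivation ℚ A A) (P Q : Op A) : Op A := mul D P Q - mul D Q P

/-- `Q` is the formal adjoint `∑_i (-D)^i · f_i` of `P = ∑_i f_i D^i`: the coefficient of `D^k` is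
`∑_{r ≥ 0} (-1)^{k+r} binom(k+r, r) D^r(f_{k+r})`. -/
def IsAdjoint (D : Derivation ℚ A A) (P Q : Op A) : Prop :=
  ∀ k : ℤ, HasSum (fun r : ℕ =>
    ((k + r).negOnePow : ℤ) • (Ring.choose (k + r) r • (⇑D)^[r] (P (k + r)))) (Q k)

/-- A ring of formal operators: a group of formal operators that contains the powers of `D`, is
stable under the projections, and on which the Leibniz product converges coefficientwise, stays
inside, and is associative. -/
structure OperatorRing (D : Derivation ℚ A A) where
  carrier : AddSubgroup (Op A)
  dpow_mem : ∀ i, dpow A i ∈ carrier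
  pos_mem : ∀ P ∈ carrier, pos P ∈ carrier
  neg_mem : ∀ P ∈ carrier, neg P ∈ carrier
  summable : ∀ P ∈ carrier, ∀ Q ∈ carrier, ∀ k, Summable (leibnizTerm D P Q k)
  mul_mem : ∀ P ∈ carrier, ∀ Q ∈ carrier, mul D P Q ∈ carrier
  mul_assoc : ∀ P ∈ carrier, ∀ Q ∈ carrier, ∀ R ∈ carrier,
    mul D (mul D P Q) R = mul D P (mul D Q R)

/-- `Γ_L = ∑_{k odd, k > 0} (k / 2n) t_k D^{k-2n}`. -/
def gammaL (n : ℕ) (t : ℕ → A) : Op A := fun i =>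
  if Odd i ∧ 0 < i + 2 * n then
    (((i + 2 * n : ℤ) : ℚ) / (2 * n)) • t (i + 2 * n).toNat
  else 0

/-- `Γ̂_R = -(x/2) D^3 - (1/2) ∑_{k odd, k > 0} k t̂_k D^{2-k}`. -/
def gammaR (x : A) (th : ℕ → A) : Op A := fun i =>
  if i = 3 then -((1 / 2 : ℚ) • x)
  else if Odd i ∧ 0 < 2 - i then -((((2 - i : ℤ) : ℚ) / 2) • th (2 - i).toNat)
  else 0

end Operators

/-- The coefficient algebra with its `x`-derivation `D`, the times `t_k`, `t̂_k` (only odd indices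
matter, and `t_1 = x`), the derivations `∂/∂t_k`, `∂/∂t̂_k`, and the two rings of formal operators:
`minus`, in which `Φ` lives, and `plus`, in which `Φ̂` lives. -/
structure Setting (A : Type*) [CommRing A] [Algebra ℚ A] [TopologicalSpace A] where
  D : Derivation ℚ A A
  t : ℕ → A
  th : ℕ → A
  dt : ℕ → Derivation ℚ A A
  dth : ℕ → Derivation ℚ A A
  dt_t : ∀ j k, Odd j → Odd k → dt j (t k) = if j = k then 1 else 0
  dt_th : ∀ j k, Odd j → Odd k → dt j (th k) = 0
  dth_t : ∀ j k, Odd j → Odd k → dth j (t k) = 0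
  dth_th : ∀ j k, Odd j → Odd k → dth j (th k) = if j = k then 1 else 0
  dt_dt : ∀ j k, Odd j → Odd k → ∀ f, dt j (dt k f) = dt k (dt j f)
  dt_dth : ∀ j k, Odd j → Odd k → ∀ f, dt j (dth k f) = dth k (dt j f)
  dth_dth : ∀ j k, Odd j → Odd k → ∀ f, dth j (dth k f) = dth k (dth j f)
  dt_one : dt 1 = D
  minus : OperatorRing D
  plus : OperatorRing D
  pos_minus : ∀ P ∈ minus.carrier, pos P ∈ plus.carrier
  neg_plus : ∀ P ∈ plus.carrier, neg P ∈ minus.carrier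

variable {A : Type*} [CommRing A] [Algebra ℚ A] [TopologicalSpace A]

/-- A pair of dressing operators `Φ = 1 + ∑_{i ≥ 1} a_i D^{-i}`, `Φ̂ = 1 + ∑_{i ≥ 1} b_i D^i` of
B type, with their inverses. -/
structure Dressing (S : Setting A) where
  Φ : Op A
  Φinv : Op A
  Φh : Op A
  Φhinv : Op A
  Φ_mem : Φ ∈ S.minus.carrier
  Φinv_mem : Φinv ∈ S.minus.carrier
  Φh_mem : Φh ∈ S.plus.carrier
  Φhinv_mem : Φhinv ∈ S.plus.carrier
  Φ_zero : Φ 0 = 1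
  Φ_pos : ∀ i, 0 < i → Φ i = 0
  Φh_zero : Φh 0 = 1
  Φh_neg : ∀ i, i < 0 → Φh i = 0
  Φ_mul_inv : mul S.D Φ Φinv = dpow A 0
  Φ_inv_mul : mul S.D Φinv Φ = dpow A 0
  Φh_mul_inv : mul S.D Φh Φhinv = dpow A 0
  Φh_inv_mul : mul S.D Φhinv Φh = dpow A 0
  Φ_adjoint : IsAdjoint S.D Φ (mul S.D (mul S.D (dpow A 1) Φinv) (dpow A (-1)))
  Φh_adjoint : IsAdjoint S.D Φh (mul S.D (mul S.D (dpow A 1) Φhinv) (dpow A (-1)))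

namespace Dressing

variable {S : Setting A} (W : Dressing S)

/-- `L = Φ D Φ⁻¹`. -/
def L : Op A := mul S.D (mul S.D W.Φ (dpow A 1)) W.Φinv

/-- `L̂ = Φ̂ D⁻¹ Φ̂⁻¹`. -/
def Lh : Op A := mul S.D (mul S.D W.Φh (dpow A (-1))) W.Φhinv

/-- `L̂⁻¹ = Φ̂ D Φ̂⁻¹`. -/
def Lhinv : Op A := mul S.D (mul S.D W.Φh (dpow A 1)) W.Φhinv

/-- The Lax operator `𝓛 = L^{2n}` of the reduced hierarchy. -/
def Lax (n : ℕ) : Op A := pow S.D W.L (2 * n)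

/-- The Orlov–Schulman operator `𝓜 = Φ Γ_L Φ⁻¹`. -/
def M (n : ℕ) : Op A := mul S.D (mul S.D W.Φ (gammaL n S.t)) W.Φinv

/-- The Orlov–Schulman operator `𝓜̂ = Φ̂ Γ̂_R Φ̂⁻¹`, with `x = t_1`. -/
def Mh : Op A := mul S.D (mul S.D W.Φh (gammaR (S.t 1) S.th)) W.Φhinv

/-- `𝓑_{m,l} = (𝓜 - 𝓜̂)^m 𝓛^l`. -/
def B (n m l : ℕ) : Op A := mul S.D (pow S.D (W.M n - W.Mh) m) (pow S.D (W.Lax n) l)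

/-- The dressing operators solve the two-component BKP hierarchy. -/
structure SolvesBKP : Prop where
  dt_Φ : ∀ k, Odd k → act (S.dt k) W.Φ = -mul S.D (neg (pow S.D W.L k)) W.Φ
  dt_Φh : ∀ k, Odd k → act (S.dt k) W.Φh =
    mul S.D (pos (pow S.D W.L k) - if k = 1 then W.Lhinv else 0) W.Φh
  dth_Φ : ∀ k, Odd k → act (S.dth k) W.Φ = -mul S.D (neg (pow S.D W.Lh k)) W.Φ
  dth_Φh : ∀ k, Odd k → act (S.dth k) W.Φh = mul S.D (pos (pow S.D W.Lh k)) W.Φh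

/-- The dressing operators solve the D-type Drinfeld–Sokolov hierarchy, that is, the two-component
BKP hierarchy reduced by `L^{2n} = L̂^2`. The last two conditions say that the Orlov–Schulman
operators are defined. -/
structure SolvesDS (n : ℕ) : Prop extends W.SolvesBKP where
  constraint : pow S.D W.L (2 * n) = pow S.D W.Lh 2
  gammaL_mem : gammaL n S.t ∈ S.minus.carrier
  gammaR_mem : gammaR (S.t 1) S.th ∈ S.plus.carrier

/-- `δ` is the additional flow `∂/∂c_{m,l}`: a continuous derivation of the coefficients that
commutes with `D`, does not act on the times, respects the two rings of operators, and satisfies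
`δ Φ = -(𝓑_{m,l})_- Φ` and `δ Φ̂ = (𝓑_{m,l})_+ Φ̂`. -/
structure IsBlockFlow (n m l : ℕ) (δ : Derivation ℚ A A) : Prop where
  continuous : Continuous δ
  comm_D : ∀ f, δ (S.D f) = S.D (δ f)
  apply_t : ∀ k, Odd k → δ (S.t k) = 0
  apply_th : ∀ k, Odd k → δ (S.th k) = 0
  act_minus : ∀ P ∈ S.minus.carrier, act δ P ∈ S.minus.carrier
  act_plus : ∀ P ∈ S.plus.carrier, act δ P ∈ S.plus.carrier
  act_Φ : act δ W.Φ = -mul S.D (neg (W.B n m l)) W.Φ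
  act_Φh : act δ W.Φh = mul S.D (pos (W.B n m l)) W.Φh

/-- Products that mix `𝓜` and `𝓜̂` are defined: both, and `𝓛`, lie in a common ring of formal
operators, whose negative parts can be composed with `Φ` and whose nonnegative parts can be composed
with `Φ̂`. -/
def MixedProductsDefined (n : ℕ) : Prop :=
  ∃ R : OperatorRing S.D,
    W.Lax n ∈ R.carrier ∧ W.M n ∈ R.carrier ∧ W.Mh ∈ R.carrier ∧
    (∀ P ∈ R.carrier, neg P ∈ S.minus.carrier) ∧ (∀ P ∈ R.carrier, pos P ∈ S.plus.carrier)

end Dressing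

end DrinfeldSokolov

end

/-!
Conjugating `Γ_L` and `Γ̂_R` by the dressing operators gives `[𝓛, 𝓜] = [𝓛, 𝓜̂] = 1`. The flow
`∂/∂c_{m,l}` acts on `𝓛` and `𝓜` as the commutator with `-(𝓑_{m,l})_-`, and on `𝓛` and `𝓜̂` as the
commutator with `(𝓑_{m,l})_+`; the two actions on `𝓛` agree since `𝓜 - 𝓜̂` commutes with `𝓛`.
For `𝓑₁ = 𝓑_{m,l}`, `𝓑₂ = 𝓑_{s,k}` and `ν = 𝓜 - 𝓜̂`, the first flow satisfies
`∂₁ν = [-𝓑₁₋, ν] + [𝓜̂, 𝓑₁]`, where `[𝓜̂, 𝓑₁] = [𝓜̂, ν^m] 𝓛^l - l ν^m 𝓛^{l-1}`. In `∂₁𝓑₂ - ∂₂𝓑₁` the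
contributions of `[𝓜̂, ν^m]` and `[𝓜̂, ν^s]` cancel, because both come from `[𝓜̂, ν]` by commuting
operations, and one is left with the total equation
`∂₁𝓑₂ - ∂₂𝓑₁ = [𝓑₁₊, 𝓑₂₊] - [𝓑₁₋, 𝓑₂₋] + (km - sl) 𝓑_{m+s-1,k+l-1}`.
Its projections are the zero-curvature equations for `-𝓑₋` and for `𝓑₊`, which are the commutation
relations of the flows on `Φ` and on `Φ̂`.

For `m = s = 1` no product of `𝓜` with `𝓜̂` is needed, because
`𝓜𝓛^l - (𝓑_{1,l})_- = 𝓜̂𝓛^l + (𝓑_{1,l})_+` lies in both rings of operators: the total equation is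
the difference of the equations for `∂₁(𝓜𝓛^k) - ∂₂(𝓜𝓛^l)` and `∂₁(𝓜̂𝓛^k) - ∂₂(𝓜̂𝓛^l)`.
-/

noncomputable section

namespace DrinfeldSokolov

attribute [local instance] LieRing.ofAssociativeRing

section RingIdentities

open Finset LinearMap

variable {T : Type*} [Ring T]

/-- The derivative of `x ↦ x ^ s` at `x` in a noncommutative ring, that is, the additive map
`c ↦ ∑_{i < s} x ^ i * c * x ^ (s - 1 - i)`, encoded as a geometric sum of the commuting operators
of left and right multiplication by `x`. It computes the action of a derivation on powers. -/
def powDeriv (x : T) (s : ℕ) : Module.End ℤ T :=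
  ∑ i ∈ range s, mulLeft ℤ x ^ i * mulRight ℤ x ^ (s - 1 - i)

lemma powDeriv_apply (x : T) (s : ℕ) (c : T) :
    powDeriv x s c = ∑ i ∈ range s, x ^ i * (c * x ^ (s - 1 - i)) := by
  simp only [powDeriv, pow_mulLeft, pow_mulRight, LinearMap.sum_apply, Module.End.mul_apply,
    mulLeft_apply, mulRight_apply]

lemma powDeriv_zero (x : T) : powDeriv x 0 = 0 := by
  rw [powDeriv, sum_range_zero]

lemma powDeriv_succ_apply (x : T) (s : ℕ) (c : T) :
    powDeriv x (s + 1) c = powDeriv x s c * x + x ^ s * c := by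
  have h := (commute_mulLeft_right (R := ℤ) x x).geom_sum₂_succ_eq (n := s)
  rw [add_comm (_ * x)]
  simpa [powDeriv, pow_mulLeft, sum_mul] using congr($h c)

lemma powDeriv_lie (g x : T) (s : ℕ) : powDeriv x s ⁅g, x⁆ = ⁅g, x ^ s⁆ := by
  have h := (commute_mulLeft_right (R := ℤ) x x).geom_sum₂_mul s
  rw [← lie_skew g x, ← lie_skew g (x ^ s), map_neg]
  simpa [powDeriv, pow_mulLeft, pow_mulRight, Ring.lie_def] using congr(-$h g)

lemma powDeriv_comm (x : T) (m s : ℕ) : Commute (powDeriv x m) (powDeriv x s) := by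
  have h := commute_mulLeft_right (R := ℤ) x x
  refine Commute.sum_left _ _ _ fun i _ => Commute.sum_right _ _ _ fun j _ => ?_
  exact (((Commute.refl _).pow_pow i j).mul_right (h.pow_pow i _)).mul_left
    ((h.symm.pow_pow _ j).mul_right ((Commute.refl _).pow_pow _ _))

lemma powDeriv_of_commute {x c : T} (h : Commute x c) (s : ℕ) :
    powDeriv x s c = s • (x ^ (s - 1) * c) := by
  rw [powDeriv_apply, sum_congr rfl, sum_const, card_range]
  intro i hi
  rw [← (h.pow_left _).eq, ← mul_assoc, ← pow_add, Nat.add_sub_cancel' (by grind)]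

lemma powDeriv_mul_right {x y : T} (h : Commute x y) (c : T) (s : ℕ) :
    powDeriv x s (c * y) = powDeriv x s c * y := by
  simp only [powDeriv_apply, sum_mul, mul_assoc, (h.pow_left _).eq]

lemma nsmul_pow_pred_mul_pow (x : T) (l k : ℕ) :
    l • (x ^ (l - 1) * x ^ k) = l • x ^ (k + l - 1) := by
  rcases Nat.eq_zero_or_pos l with rfl | hl
  · simp only [zero_smul]
  · rw [← pow_add]
    congr 2
    omega

lemma lie_pow_of_lie_eq_one {x g : T} (h : ⁅x, g⁆ = 1) (l : ℕ) : ⁅x ^ l, g⁆ = l • x ^ (l - 1) := by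
  rw [← lie_skew, ← powDeriv_lie, ← map_neg, lie_skew, h,
    powDeriv_of_commute (Commute.one_right x), mul_one]

lemma lie_mul_pow_mul_pow {Λ μ : T} (h : ⁅Λ, μ⁆ = 1) (l k : ℕ) :
    ⁅μ * Λ ^ l, μ * Λ ^ k⁆ = ((l : ℤ) - k) • (μ * Λ ^ (k + l - 1)) := by
  calc ⁅μ * Λ ^ l, μ * Λ ^ k⁆
      = μ * (⁅Λ ^ l, μ⁆ * Λ ^ k) - μ * (⁅Λ ^ k, μ⁆ * Λ ^ l) +
          μ * μ * (Λ ^ l * Λ ^ k - Λ ^ k * Λ ^ l) := by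
        simp only [Ring.lie_def]; noncomm_ring
    _ = ((l : ℤ) - k) • (μ * Λ ^ (k + l - 1)) := by
        rw [lie_pow_of_lie_eq_one h, lie_pow_of_lie_eq_one h, smul_mul_assoc, smul_mul_assoc,
          nsmul_pow_pred_mul_pow, nsmul_pow_pred_mul_pow, add_comm l k, pow_mul_comm, sub_self,
          mul_zero, add_zero, sub_smul, natCast_zsmul, natCast_zsmul, mul_smul_comm,
          mul_smul_comm]

/-- The first summand on the right is symmetric in `(m, l)` and `(s, k)`, by `powDeriv_comm`. -/
lemma powDeriv_lie_mul_pow {ν Λ g : T} (h : Commute ν Λ) (hg : ⁅Λ, g⁆ = 1) (m l s k : ℕ) :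
    powDeriv ν s ⁅g, ν ^ m * Λ ^ l⁆ * Λ ^ k =
      powDeriv ν s (powDeriv ν m ⁅g, ν⁆) * Λ ^ (k + l) -
        (s * l) • (ν ^ (m + s - 1) * Λ ^ (k + l - 1)) := by
  have leibniz : ⁅g, ν ^ m * Λ ^ l⁆ =
      powDeriv ν m ⁅g, ν⁆ * Λ ^ l - ν ^ m * (l • Λ ^ (l - 1)) := by
    rw [powDeriv_lie, ← lie_pow_of_lie_eq_one hg]
    simp only [Ring.lie_def]
    noncomm_ring
  have commutes : Commute ν (ν ^ m * (l • Λ ^ (l - 1))) :=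
    (Commute.self_pow ν m).mul_right ((h.pow_right _).smul_right l)
  have symmetric_part : powDeriv ν s (powDeriv ν m ⁅g, ν⁆ * Λ ^ l) * Λ ^ k =
      powDeriv ν s (powDeriv ν m ⁅g, ν⁆) * Λ ^ (k + l) := by
    rw [powDeriv_mul_right (h.pow_right l), mul_assoc, ← pow_add, add_comm l k]
  have remainder : powDeriv ν s (ν ^ m * (l • Λ ^ (l - 1))) * Λ ^ k =
      (s * l) • (ν ^ (m + s - 1) * Λ ^ (k + l - 1)) := by
    calc _ = s • (ν ^ (s - 1) * ν ^ m) * l • (Λ ^ (l - 1) * Λ ^ k) := by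
          rw [powDeriv_of_commute commutes]
          simp only [smul_mul_assoc, mul_smul_comm, mul_assoc]
          exact smul_comm _ _ _
      _ = _ := by rw [nsmul_pow_pred_mul_pow, nsmul_pow_pred_mul_pow, smul_mul_smul_comm]
  rw [leibniz, map_sub, sub_mul, symmetric_part, remainder]

lemma powDeriv_lie_sub_powDeriv_lie {ν Λ g : T} (h : Commute ν Λ) (hg : ⁅Λ, g⁆ = 1)
    (m l s k : ℕ) :
    powDeriv ν s ⁅g, ν ^ m * Λ ^ l⁆ * Λ ^ k - powDeriv ν m ⁅g, ν ^ s * Λ ^ k⁆ * Λ ^ l =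
      ((k : ℤ) * m - s * l) • (ν ^ (m + s - 1) * Λ ^ (k + l - 1)) := by
  have symm : powDeriv ν s (powDeriv ν m ⁅g, ν⁆) = powDeriv ν m (powDeriv ν s ⁅g, ν⁆) :=
    congr($(powDeriv_comm ν s m) ⁅g, ν⁆)
  rw [powDeriv_lie_mul_pow h hg m l s k, powDeriv_lie_mul_pow h hg s k m l, symm, add_comm l k,
    add_comm s m, sub_sub_sub_cancel_left, sub_smul, ← natCast_zsmul, ← natCast_zsmul]
  push_cast
  rw [mul_comm (m : ℤ)]

lemma conj_lie (u : Tˣ) (x y : T) :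
    ⁅u * x * (u⁻¹ : Tˣ), u * y * (u⁻¹ : Tˣ)⁆ = u * ⁅x, y⁆ * (u⁻¹ : Tˣ) := by
  simp [Ring.lie_def, mul_sub, sub_mul, mul_assoc]

lemma lie_sub_lie_eq_lie_add {𝔤 : Type*} [LieRing 𝔤] (x₁ x₂ a₁ a₂ : 𝔤) :
    ⁅x₁, a₂⁆ - ⁅x₂, a₁⁆ = ⁅a₁ + x₁, a₂ + x₂⁆ - ⁅x₁, x₂⁆ - ⁅a₁, a₂⁆ := by
  rw [← lie_skew x₂ a₁, add_lie, lie_add, lie_add]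
  abel

end RingIdentities

namespace Op

variable {A : Type*} [CommRing A]

lemma neg_add_pos_self (P : Op A) : neg P + pos P = P := by
  ext i
  simp only [neg, pos, Pi.add_apply]
  grind

protected lemma neg_add (P Q : Op A) : neg (P + Q) = neg P + neg Q := by
  ext i; simp [neg, ite_add_ite]

protected lemma neg_sub (P Q : Op A) : neg (P - Q) = neg P - neg Q := by
  ext i; simp [neg, ite_sub_ite]

protected lemma neg_zsmul (c : ℤ) (P : Op A) : neg (c • P) = c • neg P := by
  ext i; simp [neg]

protected lemma pos_add (P Q : Op A) : pos (P + Q) = pos P + pos Q := by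
  ext i; simp [pos, ite_add_ite]

protected lemma pos_sub (P Q : Op A) : pos (P - Q) = pos P - pos Q := by
  ext i; simp [pos, ite_sub_ite]

protected lemma pos_zsmul (c : ℤ) (P : Op A) : pos (c • P) = c • pos P := by
  ext i; simp [pos]

lemma neg_eq_self {P : Op A} (h : ∀ k, 0 ≤ k → P k = 0) : neg P = P := by
  ext i
  grind [neg]

lemma pos_eq_self {P : Op A} (h : ∀ k < 0, P k = 0) : pos P = P := by
  ext i
  grind [pos]

lemma pos_eq_zero {P : Op A} (h : ∀ k, 0 ≤ k → P k = 0) : pos P = 0 := by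
  ext i
  simpa [pos] using h i

lemma neg_eq_zero {P : Op A} (h : ∀ k < 0, P k = 0) : neg P = 0 := by
  ext i
  simpa [neg] using h i

end Op

section Operators

variable {A : Type*} [CommRing A] [Algebra ℚ A]

lemma act_neg_part (δ : Derivation ℚ A A) (P : Op A) : act δ (neg P) = neg (act δ P) := by
  ext i; simp [neg, act, apply_ite δ]

lemma act_pos_part (δ : Derivation ℚ A A) (P : Op A) : act δ (pos P) = pos (act δ P) := by
  ext i; simp [pos, act, apply_ite δ]

lemma act_sub (δ : Derivation ℚ A A) (P Q : Op A) : act δ (P - Q) = act δ P - act δ Q := by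
  ext i; simp [act]

lemma act_neg (δ : Derivation ℚ A A) (P : Op A) : act δ (-P) = -act δ P := by
  ext i; simp [act]

lemma act_dpow (δ : Derivation ℚ A A) (i : ℤ) : act δ (dpow A i) = 0 := by
  ext j
  simp [act, dpow, Pi.single_apply, apply_ite δ]

lemma leibnizTerm_add_left (D : Derivation ℚ A A) (P P' Q : Op A) (k : ℤ) (p : ℤ × ℕ) :
    leibnizTerm D (P + P') Q k p = leibnizTerm D P Q k p + leibnizTerm D P' Q k p := by
  simp only [leibnizTerm, Pi.add_apply, add_mul, smul_add]

lemma leibnizTerm_add_right (D : Derivation ℚ A A) (P Q Q' : Op A) (k : ℤ) (p : ℤ × ℕ) :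
    leibnizTerm D P (Q + Q') k p = leibnizTerm D P Q k p + leibnizTerm D P Q' k p := by
  simp only [leibnizTerm, Pi.add_apply, iterate_map_add, mul_add, smul_add]

lemma map_leibnizTerm {D δ : Derivation ℚ A A} (h : Function.Commute δ D) (P Q : Op A)
    (k : ℤ) (p : ℤ × ℕ) :
    δ (leibnizTerm D P Q k p) = leibnizTerm D (act δ P) Q k p + leibnizTerm D P (act δ Q) k p := by
  have iterates (f : A) : δ ((⇑D)^[p.2] f) = (⇑D)^[p.2] (δ f) := h.iterate_right p.2 f
  simp only [leibnizTerm, act, map_zsmul, Derivation.leibniz, iterates, smul_eq_mul, ← smul_add]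
  ring_nf

variable [TopologicalSpace A] (D : Derivation ℚ A A)

lemma mul_dpow (Q : Op A) (i : ℤ) : mul D Q (dpow A i) = fun k => Q (k - i) := by
  ext k
  rw [mul, tsum_eq_single (k - i, 0)]
  · simp [leibnizTerm, dpow]
  · rintro ⟨a, r | r⟩ hr
    · have : k - a ≠ i := fun h => hr (by simp [← h])
      simp [leibnizTerm, dpow, this]
    · have constant : D (dpow A i (k - a + ↑(r + 1))) = 0 := congrFun (act_dpow D i) _
      rw [leibnizTerm, Function.iterate_succ_apply, constant, iterate_map_zero, mul_zero, smul_zero]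

lemma mul_dpow_zero (Q : Op A) : mul D Q (dpow A 0) = Q := by
  simp only [mul_dpow, sub_zero]

lemma dpow_zero_mul (Q : Op A) : mul D (dpow A 0) Q = Q := by
  ext k
  rw [mul, tsum_eq_single (0, 0)]
  · simp [leibnizTerm, dpow]
  · rintro ⟨a, r⟩ hr
    by_cases ha : a = 0
    · subst ha
      have : 0 < r := Nat.pos_of_ne_zero (by simpa using hr)
      simp [leibnizTerm, Ring.choose_zero_pos ℤ this]
    · simp [leibnizTerm, dpow, ha]

lemma dpow_mul_dpow (i j : ℤ) : mul D (dpow A i) (dpow A j) = dpow A (i + j) := by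
  rw [mul_dpow]
  ext k
  simp only [dpow, Pi.single_apply, sub_eq_iff_eq_add]

variable {D} in
lemma dpow_mul_of_act_act_eq_zero {Q : Op A} (hQ : act D (act D Q) = 0) (i : ℤ) :
    mul D (dpow A i) Q = fun k => Q (k - i) + i • D (Q (k - i + 1)) := by
  have vanish (r : ℕ) (j : ℤ) : (⇑D)^[r + 2] (Q j) = 0 := by
    rw [Function.iterate_add_apply]
    exact (congrArg _ (congrFun hQ j)).trans (iterate_map_zero D r)
  ext k
  rw [mul, tsum_eq_sum (s := {(i, 0), (i, 1)})]
  · rw [Finset.sum_pair (by simp)]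
    simp [leibnizTerm, dpow]
  · rintro ⟨a, r⟩ hr
    by_cases ha : a = i
    · subst ha
      match r with
      | 0 => simp at hr
      | 1 => simp at hr
      | r + 2 => simp [leibnizTerm, vanish]
    · simp [leibnizTerm, dpow, ha]

variable {D} in
lemma comm_dpow_of_act_act_eq_zero {Q : Op A} (hQ : act D (act D Q) = 0) (i : ℤ) :
    comm D (dpow A i) Q = i • mul D (act D Q) (dpow A (i - 1)) := by
  ext k
  simp [comm, dpow_mul_of_act_act_eq_zero hQ, mul_dpow, act, sub_sub_eq_add_sub, sub_add_eq_add_sub]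

lemma mul_neg_neg (P Q : Op A) : mul D (-P) (-Q) = mul D P Q := by
  ext k
  simp [mul, leibnizTerm, iterate_map_neg]

lemma mul_neg_neg_apply (P Q : Op A) {k : ℤ} (hk : 0 ≤ k) : mul D (neg P) (neg Q) k = 0 := by
  rw [mul, tsum_congr, tsum_zero]
  rintro ⟨i, r⟩
  by_cases hi : i < 0
  · have : ¬ k - i + r < 0 := by omega
    simp [leibnizTerm, neg, this]
  · simp [leibnizTerm, neg, hi]

lemma mul_pos_pos_apply (P Q : Op A) {k : ℤ} (hk : k < 0) : mul D (pos P) (pos Q) k = 0 := by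
  rw [mul, tsum_congr, tsum_zero]
  rintro ⟨i, r⟩
  by_cases hi : 0 ≤ i
  · lift i to ℕ using hi
    rcases lt_or_ge i r with h | h
    · simp [leibnizTerm, Ring.choose_natCast, Nat.choose_eq_zero_of_lt h]
    · have : ¬ (0 : ℤ) ≤ k - i + r := by omega
      simp [leibnizTerm, pos, this]
  · simp [leibnizTerm, pos, hi]

lemma comm_neg_neg_apply (P Q : Op A) (k : ℤ) (hk : 0 ≤ k) : comm D (neg P) (neg Q) k = 0 := by
  rw [comm, Pi.sub_apply, mul_neg_neg_apply D P Q hk, mul_neg_neg_apply D Q P hk, sub_zero]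

lemma comm_pos_pos_apply (P Q : Op A) (k : ℤ) (hk : k < 0) : comm D (pos P) (pos Q) k = 0 := by
  rw [comm, Pi.sub_apply, mul_pos_pos_apply D P Q hk, mul_pos_pos_apply D Q P hk, sub_zero]

end Operators

section Products

variable {A : Type*} [CommRing A] [Algebra ℚ A] [TopologicalSpace A] [ContinuousAdd A] [T2Space A]
  {D δ : Derivation ℚ A A} {P P' Q Q' : Op A}

lemma mul_add_of_summable (h : ∀ k, Summable (leibnizTerm D P Q k))
    (h' : ∀ k, Summable (leibnizTerm D P Q' k)) : mul D P (Q + Q') = mul D P Q + mul D P Q' := by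
  ext k
  simp only [mul, leibnizTerm_add_right, Pi.add_apply]
  exact (h k).tsum_add (h' k)

lemma add_mul_of_summable (h : ∀ k, Summable (leibnizTerm D P Q k))
    (h' : ∀ k, Summable (leibnizTerm D P' Q k)) : mul D (P + P') Q = mul D P Q + mul D P' Q := by
  ext k
  simp only [mul, leibnizTerm_add_left, Pi.add_apply]
  exact (h k).tsum_add (h' k)

/-- An evolutionary derivation: a continuous derivation of the coefficients that commutes with `D`.
These are the derivations that act on convergent products of operators by the Leibniz rule. -/
structure IsEvolutionary (D δ : Derivation ℚ A A) : Prop where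
  continuous : Continuous δ
  commute : Function.Commute δ D

lemma IsEvolutionary.act_mul_of_summable (hδ : IsEvolutionary D δ)
    (h : ∀ k, Summable (leibnizTerm D P Q k)) (hl : ∀ k, Summable (leibnizTerm D (act δ P) Q k))
    (hr : ∀ k, Summable (leibnizTerm D P (act δ Q) k)) :
    act δ (mul D P Q) = mul D (act δ P) Q + mul D P (act δ Q) := by
  ext k
  rw [Pi.add_apply, act, mul, (h k).map_tsum δ hδ.continuous]
  simp only [map_leibnizTerm hδ.commute]
  exact (hl k).tsum_add (hr k)

end Products

namespace OperatorRing

variable {A : Type*} [CommRing A] [Algebra ℚ A] [TopologicalSpace A] [ContinuousAdd A] [T2Space A]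
  {D : Derivation ℚ A A} (R : OperatorRing D)

instance : Ring R.carrier where
  __ := R.carrier.toAddCommGroup
  mul x y := ⟨mul D x y, R.mul_mem _ x.2 _ y.2⟩
  one := ⟨dpow A 0, R.dpow_mem 0⟩
  mul_assoc x y z := Subtype.ext (R.mul_assoc _ x.2 _ y.2 _ z.2)
  one_mul x := Subtype.ext (dpow_zero_mul D x)
  mul_one x := Subtype.ext (mul_dpow_zero D x)
  left_distrib x y z := Subtype.ext
    (mul_add_of_summable (R.summable _ x.2 _ y.2) (R.summable _ x.2 _ z.2))
  right_distrib x y z := Subtype.ext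
    (add_mul_of_summable (R.summable _ x.2 _ z.2) (R.summable _ y.2 _ z.2))
  zero_mul x := Subtype.ext (funext fun k => show mul D 0 x k = 0 by simp [mul, leibnizTerm])
  mul_zero x := Subtype.ext (funext fun k => show mul D x 0 k = 0 by simp [mul, leibnizTerm])

/-- The operator `D^i` as an element of the ring `R`. -/
def dx (i : ℤ) : R.carrier := ⟨dpow A i, R.dpow_mem i⟩

lemma dx_pow (i : ℤ) (j : ℕ) : R.dx i ^ j = R.dx (j * i) := by
  induction j with
  | zero => rw [pow_zero, Nat.cast_zero, zero_mul]; rfl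
  | succ j ih =>
    rw [pow_succ, ih, Nat.cast_succ, add_one_mul]
    exact Subtype.ext (dpow_mul_dpow D _ _)

variable {R}

lemma coe_mul (x y : R.carrier) : ((x * y : R.carrier) : Op A) = mul D x y := rfl

lemma coe_lie (x y : R.carrier) : ((⁅x, y⁆ : R.carrier) : Op A) = comm D x y := rfl

lemma coe_pow (x : R.carrier) (j : ℕ) : ((x ^ j : R.carrier) : Op A) = pow D x j := by
  induction j with
  | zero => rw [pow_zero]; rfl
  | succ j ih => rw [pow_succ, coe_mul, ih]; rfl

lemma pow_mem {P : Op A} (hP : P ∈ R.carrier) (j : ℕ) : pow D P j ∈ R.carrier :=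
  coe_pow (⟨P, hP⟩ : R.carrier) j ▸ ((⟨P, hP⟩ : R.carrier) ^ j).2

section Derivations

variable {δ : Derivation ℚ A A}

lemma act_mul (hδ : IsEvolutionary D δ) {x y x' y' : R.carrier} (hx : act δ x = x')
    (hy : act δ y = y') : act δ (x * y : R.carrier) = (x' * y + x * y' : R.carrier) := by
  rw [coe_mul, hδ.act_mul_of_summable (R.summable _ x.2 _ y.2)
    (hx ▸ R.summable _ x'.2 _ y.2) (hy ▸ R.summable _ x.2 _ y'.2), hx, hy]
  rfl

lemma act_lie (hδ : IsEvolutionary D δ) {x y x' y' : R.carrier} (hx : act δ x = x')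
    (hy : act δ y = y') : act δ (⁅x, y⁆ : R.carrier) = (⁅x', y⁆ + ⁅x, y'⁆ : R.carrier) := by
  rw [Ring.lie_def, AddSubgroup.coe_sub, act_sub, act_mul hδ hx hy, act_mul hδ hy hx,
    ← AddSubgroup.coe_sub]
  congr 1
  simp only [Ring.lie_def]
  abel

lemma act_pow (hδ : IsEvolutionary D δ) {x x' : R.carrier} (hx : act δ x = x') (s : ℕ) :
    act δ (x ^ s : R.carrier) = (powDeriv x s x' : R.carrier) := by
  induction s with
  | zero => rw [pow_zero, powDeriv_zero]; exact act_dpow δ 0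
  | succ s ih => rw [pow_succ, act_mul hδ ih hx, powDeriv_succ_apply]

lemma act_pow_mul_pow (hδ : IsEvolutionary D δ) {c e ν Λ : R.carrier}
    (hν : act δ ν = (⁅c, ν⁆ + e : R.carrier)) (hΛ : act δ Λ = (⁅c, Λ⁆ : R.carrier)) (p q : ℕ) :
    act δ (ν ^ p * Λ ^ q : R.carrier) =
      (⁅c, ν ^ p * Λ ^ q⁆ + powDeriv ν p e * Λ ^ q : R.carrier) := by
  rw [act_mul hδ (act_pow hδ hν p) (act_pow hδ hΛ q)]
  congr 1
  rw [map_add, powDeriv_lie, powDeriv_lie]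
  simp only [Ring.lie_def]
  noncomm_ring

variable (R) in
/-- An evolutionary derivation that acts on the ring of operators `R`. -/
structure IsFlow (δ : Derivation ℚ A A) : Prop extends IsEvolutionary D δ where
  act_mem : ∀ P ∈ R.carrier, act δ P ∈ R.carrier

lemma IsFlow.act_inv (hδ : R.IsFlow δ) (u : R.carrierˣ) {c : R.carrier}
    (hu : act δ (u : R.carrier) = (c * u : R.carrier)) :
    act δ (↑u⁻¹ : R.carrier) = (-(↑u⁻¹ * c) : R.carrier) := by
  let v' : R.carrier := ⟨act δ (↑u⁻¹ : R.carrier), hδ.act_mem _ (Subtype.property _)⟩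
  have product : act δ (u * ↑u⁻¹ : R.carrier) = (c * u * ↑u⁻¹ + u * v' : R.carrier) :=
    act_mul hδ.toIsEvolutionary hu rfl
  rw [Units.mul_inv, Units.mul_inv_cancel_right] at product
  have vanish : c + u * v' = 0 := Subtype.ext (product.symm.trans (act_dpow δ 0))
  have solved : v' = -(↑u⁻¹ * c) := by
    rw [← mul_neg, Units.eq_inv_mul_iff_mul_eq, eq_neg_of_add_eq_zero_right vanish]
  exact congrArg Subtype.val solved

lemma IsFlow.act_conj (hδ : R.IsFlow δ) (u : R.carrierˣ) {c x : R.carrier}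
    (hu : act δ (u : R.carrier) = (c * u : R.carrier)) (hx : act δ x = 0) :
    act δ (u * x * ↑u⁻¹ : R.carrier) = (⁅c, u * x * ↑u⁻¹⁆ : R.carrier) := by
  have outer := act_mul hδ.toIsEvolutionary
    (act_mul (y' := 0) hδ.toIsEvolutionary hu hx) (hδ.act_inv u hu)
  rw [outer, Ring.lie_def]
  congr 1
  noncomm_ring

lemma act_sub_act_eq_lie {δ₁ δ₂ : Derivation ℚ A A} {x₁ x₂ a₁ a₂ e₁ e₂ : R.carrier}
    (h₁ : act δ₁ a₂ = (⁅x₁, a₂⁆ + e₂ : R.carrier)) (h₂ : act δ₂ a₁ = (⁅x₂, a₁⁆ + e₁ : R.carrier)) :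
    act δ₁ a₂ - act δ₂ a₁ =
      (⁅a₁ + x₁, a₂ + x₂⁆ - ⁅x₁, x₂⁆ - ⁅a₁, a₂⁆ + (e₂ - e₁) : R.carrier) := by
  rw [h₁, h₂, ← lie_sub_lie_eq_lie_add, ← AddSubgroup.coe_sub]
  congr 1
  abel

variable {δ₁ δ₂ : Derivation ℚ A A} {Λ μ μ' x₁ x₂ y₁ y₂ : R.carrier}

lemma act_sub_act_mul_pow (h : ⁅Λ, μ⁆ = 1)
    (hδ₁ : IsEvolutionary D δ₁) (hδ₂ : IsEvolutionary D δ₂)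
    (hΛ₁ : act δ₁ Λ = (⁅x₁, Λ⁆ : R.carrier)) (hμ₁ : act δ₁ μ = (⁅x₁, μ⁆ : R.carrier))
    (hΛ₂ : act δ₂ Λ = (⁅x₂, Λ⁆ : R.carrier)) (hμ₂ : act δ₂ μ = (⁅x₂, μ⁆ : R.carrier)) (l k : ℕ) :
    act δ₁ (μ * Λ ^ k : R.carrier) - act δ₂ (μ * Λ ^ l : R.carrier) =
      (⁅μ * Λ ^ l + x₁, μ * Λ ^ k + x₂⁆ - ⁅x₁, x₂⁆ +
        ((k : ℤ) - l) • (μ * Λ ^ (k + l - 1)) : R.carrier) := by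
  have flow₁ := act_pow_mul_pow (e := 0) hδ₁ (by rwa [add_zero]) hΛ₁ 1 k
  have flow₂ := act_pow_mul_pow (e := 0) hδ₂ (by rwa [add_zero]) hΛ₂ 1 l
  rw [map_zero, zero_mul, pow_one] at flow₁ flow₂
  rw [act_sub_act_eq_lie flow₁ flow₂, lie_mul_pow_mul_pow h, sub_zero, add_zero, sub_eq_add_neg,
    ← neg_smul, neg_sub]

lemma act_sub_act_pow_mul_pow (hμ : ⁅Λ, μ⁆ = 1) (hμ' : ⁅Λ, μ'⁆ = 1)
    (hδ₁ : IsEvolutionary D δ₁) (hδ₂ : IsEvolutionary D δ₂)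
    (hΛ₁ : act δ₁ Λ = (⁅x₁, Λ⁆ : R.carrier)) (hμ₁ : act δ₁ μ = (⁅x₁, μ⁆ : R.carrier))
    (hμ'₁ : act δ₁ μ' = (⁅y₁, μ'⁆ : R.carrier))
    (hΛ₂ : act δ₂ Λ = (⁅x₂, Λ⁆ : R.carrier)) (hμ₂ : act δ₂ μ = (⁅x₂, μ⁆ : R.carrier))
    (hμ'₂ : act δ₂ μ' = (⁅y₂, μ'⁆ : R.carrier)) {m l s k : ℕ}
    (hy₁ : (μ - μ') ^ m * Λ ^ l + x₁ = y₁) (hy₂ : (μ - μ') ^ s * Λ ^ k + x₂ = y₂) :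
    act δ₁ ((μ - μ') ^ s * Λ ^ k : R.carrier) - act δ₂ ((μ - μ') ^ m * Λ ^ l : R.carrier) =
      (⁅y₁, y₂⁆ - ⁅x₁, x₂⁆ +
        ((k : ℤ) * m - s * l) • ((μ - μ') ^ (m + s - 1) * Λ ^ (k + l - 1)) : R.carrier) := by
  have commute : Commute (μ - μ') Λ := by
    rw [commute_iff_lie_eq, ← lie_skew, lie_sub, hμ, hμ', sub_self, neg_zero]
  have difference {δ : Derivation ℚ A A} {x y b : R.carrier}
      (hμ : act δ μ = (⁅x, μ⁆ : R.carrier)) (hμ' : act δ μ' = (⁅y, μ'⁆ : R.carrier))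
      (hy : b + x = y) : act δ (μ - μ' : R.carrier) = (⁅x, μ - μ'⁆ + ⁅μ', b⁆ : R.carrier) := by
    rw [AddSubgroup.coe_sub, act_sub, hμ, hμ', ← AddSubgroup.coe_sub, ← hy]
    congr 1
    rw [← lie_skew μ' b, add_lie, lie_sub]
    abel
  have flow₁ := act_pow_mul_pow hδ₁ (difference hμ₁ hμ'₁ hy₁) hΛ₁ s k
  have flow₂ := act_pow_mul_pow hδ₂ (difference hμ₂ hμ'₂ hy₂) hΛ₂ m l
  have abelian : ⁅(μ - μ') ^ m * Λ ^ l, (μ - μ') ^ s * Λ ^ k⁆ = 0 :=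
    Commute.lie_eq <| ((Commute.refl _).pow_pow m s |>.mul_right (commute.pow_pow m k)).mul_left
      ((commute.symm.pow_pow l s).mul_right ((Commute.refl _).pow_pow l k))
  rw [act_sub_act_eq_lie flow₁ flow₂, powDeriv_lie_sub_powDeriv_lie commute hμ', hy₁, hy₂, abelian,
    sub_zero]

end Derivations

end OperatorRing

section ZeroCurvature

variable {A : Type*} [CommRing A] [Algebra ℚ A] [TopologicalSpace A]

/-- The zero-curvature equation `δ₁ X₂ - δ₂ X₁ = [X₁, X₂] + Z`. It is the compatibility condition of
the equations `δ₁ Φ = X₁ Φ` and `δ₂ Φ = X₂ Φ` with the equation `[δ₁, δ₂] Φ = Z Φ`. -/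
def ZeroCurvature (D δ₁ δ₂ : Derivation ℚ A A) (X₁ X₂ Z : Op A) : Prop :=
  act δ₁ X₂ - act δ₂ X₁ = comm D X₁ X₂ + Z

variable {D δ₁ δ₂ : Derivation ℚ A A} {P₁ P₂ Z : Op A}

lemma ZeroCurvature.pos_of_act_sub_act (h : act δ₁ P₂ - act δ₂ P₁ =
      comm D (pos P₁) (pos P₂) - comm D (neg P₁) (neg P₂) + Z) :
    ZeroCurvature D δ₁ δ₂ (pos P₁) (pos P₂) (pos Z) := by
  rw [ZeroCurvature, act_pos_part, act_pos_part, ← Op.pos_sub, h, Op.pos_add, Op.pos_sub,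
    Op.pos_eq_self (comm_pos_pos_apply D P₁ P₂), Op.pos_eq_zero (comm_neg_neg_apply D P₁ P₂),
    sub_zero]

lemma ZeroCurvature.neg_of_act_sub_act (h : act δ₁ P₂ - act δ₂ P₁ =
      comm D (pos P₁) (pos P₂) - comm D (neg P₁) (neg P₂) + Z) :
    ZeroCurvature D δ₁ δ₂ (-neg P₁) (-neg P₂) (-neg Z) := by
  have projected : neg (act δ₁ P₂) - neg (act δ₂ P₁) = -comm D (neg P₁) (neg P₂) + neg Z := by
    rw [← Op.neg_sub, h, Op.neg_add, Op.neg_sub, Op.neg_eq_self (comm_neg_neg_apply D P₁ P₂),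
      Op.neg_eq_zero (comm_pos_pos_apply D P₁ P₂), zero_sub]
  rw [ZeroCurvature, act_neg, act_neg, act_neg_part, act_neg_part, comm, mul_neg_neg, mul_neg_neg,
    ← comm, ← neg_sub', projected, neg_add, neg_neg]

lemma zsmul_congr_of_ne_zero {G : Type*} [AddGroup G] {c : ℤ} {x y : G} (h : c ≠ 0 → x = y) :
    c • x = c • y := by
  rcases eq_or_ne c 0 with rfl | hc
  · rw [zero_zsmul, zero_zsmul]
  · rw [h hc]

open OperatorRing

variable [ContinuousAdd A] [T2Space A] {R : OperatorRing D} {x₁ x₂ z : R.carrier}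
  {δ₃ : Derivation ℚ A A} {c : ℤ}

lemma ZeroCurvature.act_act_sub_of_act_eq_mul
    (h : ZeroCurvature D δ₁ δ₂ x₁ x₂ (c • z : R.carrier))
    (hδ₁ : R.IsFlow δ₁) (hδ₂ : R.IsFlow δ₂) {φ : R.carrier}
    (h₁ : act δ₁ φ = (x₁ * φ : R.carrier)) (h₂ : act δ₂ φ = (x₂ * φ : R.carrier))
    (h₃ : c ≠ 0 → act δ₃ φ = (z * φ : R.carrier)) :
    act δ₁ (act δ₂ φ) - act δ₂ (act δ₁ φ) = c • act δ₃ φ := by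
  let y₁ : R.carrier := ⟨act δ₂ x₁, hδ₂.act_mem _ x₁.2⟩
  let y₂ : R.carrier := ⟨act δ₁ x₂, hδ₁.act_mem _ x₂.2⟩
  have curvature : y₂ - y₁ = ⁅x₁, x₂⁆ + c • z := Subtype.ext h
  rw [zsmul_congr_of_ne_zero h₃, ← AddSubgroup.coe_zsmul, ← smul_mul_assoc, h₁, h₂,
    act_mul (x' := y₂) hδ₁.toIsEvolutionary rfl h₁,
    act_mul (x' := y₁) hδ₂.toIsEvolutionary rfl h₂, ← AddSubgroup.coe_sub]
  congr 1
  rw [eq_sub_of_add_eq' curvature.symm, Ring.lie_def]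
  noncomm_ring

lemma ZeroCurvature.act_act_sub_of_act_eq_lie
    (h : ZeroCurvature D δ₁ δ₂ x₁ x₂ (c • z : R.carrier))
    (hδ₁ : R.IsFlow δ₁) (hδ₂ : R.IsFlow δ₂) {Λ : R.carrier}
    (h₁ : act δ₁ Λ = (⁅x₁, Λ⁆ : R.carrier)) (h₂ : act δ₂ Λ = (⁅x₂, Λ⁆ : R.carrier))
    (h₃ : c ≠ 0 → act δ₃ Λ = (⁅z, Λ⁆ : R.carrier)) :
    act δ₁ (act δ₂ Λ) - act δ₂ (act δ₁ Λ) = c • act δ₃ Λ := by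
  let y₁ : R.carrier := ⟨act δ₂ x₁, hδ₂.act_mem _ x₁.2⟩
  let y₂ : R.carrier := ⟨act δ₁ x₂, hδ₁.act_mem _ x₂.2⟩
  have curvature : y₂ - y₁ = ⁅x₁, x₂⁆ + c • z := Subtype.ext h
  have act₁ : act δ₁ (⁅x₂, Λ⁆ : R.carrier) = (⁅y₂, Λ⁆ + ⁅x₂, ⁅x₁, Λ⁆⁆ : R.carrier) :=
    act_lie hδ₁.toIsEvolutionary rfl h₁
  have act₂ : act δ₂ (⁅x₁, Λ⁆ : R.carrier) = (⁅y₁, Λ⁆ + ⁅x₁, ⁅x₂, Λ⁆⁆ : R.carrier) :=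
    act_lie hδ₂.toIsEvolutionary rfl h₂
  rw [zsmul_congr_of_ne_zero h₃, ← AddSubgroup.coe_zsmul, ← smul_lie, h₁, h₂, act₁, act₂,
    ← AddSubgroup.coe_sub]
  congr 1
  rw [eq_sub_of_add_eq' curvature.symm, sub_lie, sub_lie, lie_lie]
  abel

end ZeroCurvature

section OrlovSchulman

variable {A : Type*} [CommRing A] [Algebra ℚ A]

lemma act_gammaL (δ : Derivation ℚ A A) (n : ℕ) (t : ℕ → A) :
    act δ (gammaL n t) = gammaL n (fun k => δ (t k)) := by
  ext i
  simp [act, gammaL, apply_ite δ, δ.map_smul]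

lemma act_gammaR (δ : Derivation ℚ A A) (x : A) (th : ℕ → A) :
    act δ (gammaR x th) = gammaR (δ x) (fun k => δ (th k)) := by
  ext i
  simp [act, gammaR, apply_ite δ, δ.map_smul]

lemma odd_toNat {i : ℤ} (h : Odd i) (hi : 0 < i) : Odd i.toNat := by
  lift i to ℕ using hi.le
  exact_mod_cast h

lemma gammaL_congr (n : ℕ) {t t' : ℕ → A} (h : ∀ k, Odd k → t k = t' k) :
    gammaL n t = gammaL n t' := by
  ext i
  refine ite_congr rfl (fun hi => ?_) fun _ => rfl
  rw [h _ (odd_toNat (hi.1.add_even (even_two_mul _)) hi.2)]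

lemma gammaR_congr (x : A) {th th' : ℕ → A} (h : ∀ k, Odd k → th k = th' k) :
    gammaR x th = gammaR x th' := by
  ext i
  refine ite_congr rfl (fun _ => rfl) fun _ => ite_congr rfl (fun hi => ?_) fun _ => rfl
  rw [h _ (odd_toNat (even_two.sub_odd hi.1) hi.2)]

lemma gammaL_zero (n : ℕ) : gammaL n (0 : ℕ → A) = 0 := by
  ext i
  simp [gammaL]

lemma gammaR_zero : gammaR (0 : A) 0 = 0 := by
  ext i
  simp [gammaR]

lemma gammaL_single_one (n : ℕ) :
    gammaL n (Pi.single 1 1 : ℕ → A) = (1 / (2 * n) : ℚ) • dpow A (1 - 2 * n) := by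
  ext i
  rcases eq_or_ne i (1 - 2 * n) with rfl | hi
  · have : Odd (1 - 2 * n : ℤ) := odd_one.sub_even (even_two_mul _)
    simp [gammaL, dpow, this]
  · have (h : 0 < i + 2 * n) : (i + 2 * n).toNat ≠ 1 := by omega
    simp +contextual [gammaL, dpow, hi, this]

lemma gammaR_one_zero : gammaR (1 : A) 0 = -(1 / 2 : ℚ) • dpow A 3 := by
  ext i
  rcases eq_or_ne i 3 with rfl | hi <;> simp [gammaR, dpow, *]

variable [TopologicalSpace A] (S : Setting A)

lemma Setting.D_t {k : ℕ} (hk : Odd k) : S.D (S.t k) = (Pi.single 1 1 : ℕ → A) k := by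
  simp [← S.dt_one, S.dt_t 1 k odd_one hk, Pi.single_apply, eq_comm]

lemma Setting.D_th {k : ℕ} (hk : Odd k) : S.D (S.th k) = 0 := by
  rw [← S.dt_one, S.dt_th 1 k odd_one hk]

lemma comm_dpow_eq_of_act_eq {D : Derivation ℚ A A} {Q : Op A} {q : ℚ} {j : ℤ}
    (h : act D Q = q • dpow A j) (i : ℤ) :
    comm D (dpow A i) Q = (i * q) • dpow A (j + i - 1) := by
  have second : act D (act D Q) = 0 := by
    rw [h]
    ext k
    simp [act, dpow, Pi.single_apply, apply_ite D]
  rw [comm_dpow_of_act_act_eq_zero second, h, mul_dpow]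
  ext k
  have shift : k - (i - 1) = j ↔ k = j + i - 1 := by omega
  simp only [Pi.smul_apply, dpow, Pi.single_apply, shift, mul_smul, Int.cast_smul_eq_zsmul]

lemma comm_dpow_gammaL {n : ℕ} (hn : n ≠ 0) :
    comm S.D (dpow A (2 * n)) (gammaL n S.t) = dpow A 0 := by
  have derivative : act S.D (gammaL n S.t) = (1 / (2 * n) : ℚ) • dpow A (1 - 2 * n) := by
    rw [act_gammaL, gammaL_congr n fun k => S.D_t, gammaL_single_one]
  rw [comm_dpow_eq_of_act_eq derivative, sub_add_cancel, sub_self]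
  push_cast
  rw [mul_one_div_cancel (by positivity), one_smul]

lemma comm_dpow_gammaR : comm S.D (dpow A (-2)) (gammaR (S.t 1) S.th) = dpow A 0 := by
  have derivative : act S.D (gammaR (S.t 1) S.th) = (-(1 / 2) : ℚ) • dpow A 3 := by
    rw [act_gammaR, gammaR_congr _ fun k => S.D_th, S.D_t odd_one, Pi.single_eq_same]
    exact gammaR_one_zero
  rw [comm_dpow_eq_of_act_eq derivative]
  norm_num

end OrlovSchulman

section Splitting

variable {A : Type*} [CommRing A] [Algebra ℚ A] [TopologicalSpace A]

/-- The condition under which the projections of `P` can be composed with dressing operators: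
`P_-` with `Φ` and `P_+` with `Φ̂`. -/
structure Splits (S : Setting A) (P : Op A) : Prop where
  neg_mem : neg P ∈ S.minus.carrier
  pos_mem : pos P ∈ S.plus.carrier

variable {S : Setting A} {P Q : Op A}

lemma Splits.of_sub (hP : P ∈ S.minus.carrier) (hQ : Q ∈ S.plus.carrier) : Splits S (P - Q) where
  neg_mem := Op.neg_sub P Q ▸ sub_mem (S.minus.neg_mem P hP) (S.neg_plus Q hQ)
  pos_mem := Op.pos_sub P Q ▸ sub_mem (S.pos_minus P hP) (S.plus.pos_mem Q hQ)

/-- The negative part of `P`, as an element of the ring that contains `Φ`. -/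
def Splits.negPart (h : Splits S P) : S.minus.carrier := ⟨neg P, h.neg_mem⟩

/-- The nonnegative part of `P`, as an element of the ring that contains `Φ̂`. -/
def Splits.posPart (h : Splits S P) : S.plus.carrier := ⟨pos P, h.pos_mem⟩

end Splitting

namespace Dressing

open OperatorRing

variable {A : Type*} [CommRing A] [Algebra ℚ A] [TopologicalSpace A] {S : Setting A}
  {W : Dressing S} {n m l s k : ℕ} {δ : Derivation ℚ A A}

lemma IsBlockFlow.isFlow_minus (h : W.IsBlockFlow n m l δ) : S.minus.IsFlow δ where
  continuous := h.continuous
  commute := h.comm_D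
  act_mem := h.act_minus

lemma IsBlockFlow.isFlow_plus (h : W.IsBlockFlow n m l δ) : S.plus.IsFlow δ where
  continuous := h.continuous
  commute := h.comm_D
  act_mem := h.act_plus

variable (W) in
/-- The part of the D-type Drinfeld–Sokolov hierarchy that involves no time evolution: the reduction
`L^{2n} = L̂^2` holds, and the Orlov–Schulman operators are defined. -/
structure IsReduced (n : ℕ) : Prop where
  constraint : pow S.D W.L (2 * n) = pow S.D W.Lh 2
  gammaL_mem : gammaL n S.t ∈ S.minus.carrier
  gammaR_mem : gammaR (S.t 1) S.th ∈ S.plus.carrier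

variable [ContinuousAdd A] [T2Space A] (W)

/-- The dressing operator `Φ` as a unit of the ring `𝒟⁻`. -/
def unitΦ : S.minus.carrierˣ where
  val := ⟨W.Φ, W.Φ_mem⟩
  inv := ⟨W.Φinv, W.Φinv_mem⟩
  val_inv := Subtype.ext W.Φ_mul_inv
  inv_val := Subtype.ext W.Φ_inv_mul

/-- The dressing operator `Φ̂` as a unit of the ring `𝒟⁺`. -/
def unitΦh : S.plus.carrierˣ where
  val := ⟨W.Φh, W.Φh_mem⟩
  inv := ⟨W.Φhinv, W.Φhinv_mem⟩
  val_inv := Subtype.ext W.Φh_mul_inv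
  inv_val := Subtype.ext W.Φh_inv_mul

/-- The Lax operator `𝓛 = Φ D^{2n} Φ⁻¹` as an element of `𝒟⁻`. -/
def laxMinus (n : ℕ) : S.minus.carrier := W.unitΦ * S.minus.dx (2 * n) * ↑W.unitΦ⁻¹

/-- The Lax operator `𝓛 = Φ̂ D^{-2} Φ̂⁻¹` as an element of `𝒟⁺`. That it agrees with `laxMinus` is
the reduction condition of the hierarchy. -/
def laxPlus : S.plus.carrier := W.unitΦh * S.plus.dx (-2) * ↑W.unitΦh⁻¹

/-- The Orlov–Schulman operator `𝓜` as an element of `𝒟⁻`. -/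
def orlovMinus (hL : gammaL n S.t ∈ S.minus.carrier) : S.minus.carrier :=
  W.unitΦ * ⟨gammaL n S.t, hL⟩ * ↑W.unitΦ⁻¹

/-- The Orlov–Schulman operator `𝓜̂` as an element of `𝒟⁺`. -/
def orlovPlus (hR : gammaR (S.t 1) S.th ∈ S.plus.carrier) : S.plus.carrier :=
  W.unitΦh * ⟨gammaR (S.t 1) S.th, hR⟩ * ↑W.unitΦh⁻¹

lemma coe_laxMinus (n : ℕ) : (W.laxMinus n : Op A) = W.Lax n := by
  have conj : W.laxMinus n = (W.unitΦ * S.minus.dx 1 * ↑W.unitΦ⁻¹) ^ (2 * n) := by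
    rw [Units.conj_pow, dx_pow, mul_one, Nat.cast_mul, Nat.cast_two, laxMinus]
  rw [conj, coe_pow]
  rfl

lemma coe_laxPlus (hconstr : pow S.D W.L (2 * n) = pow S.D W.Lh 2) :
    (W.laxPlus : Op A) = W.Lax n := by
  have conj : W.laxPlus = (W.unitΦh * S.plus.dx (-1) * ↑W.unitΦh⁻¹) ^ 2 := by
    rw [Units.conj_pow, dx_pow, Nat.cast_two, mul_neg_one, laxPlus]
  rw [conj, coe_pow, Lax, hconstr]
  rfl

lemma lie_laxMinus_orlovMinus (hn : n ≠ 0) (hL : gammaL n S.t ∈ S.minus.carrier) :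
    ⁅W.laxMinus n, W.orlovMinus hL⁆ = 1 := by
  have bare : ⁅S.minus.dx (2 * n), (⟨gammaL n S.t, hL⟩ : S.minus.carrier)⁆ = 1 :=
    Subtype.ext (comm_dpow_gammaL S hn)
  rw [laxMinus, orlovMinus, conj_lie, bare, mul_one, Units.mul_inv]

lemma lie_laxPlus_orlovPlus (hR : gammaR (S.t 1) S.th ∈ S.plus.carrier) :
    ⁅W.laxPlus, W.orlovPlus hR⁆ = 1 := by
  have bare : ⁅S.plus.dx (-2), (⟨gammaR (S.t 1) S.th, hR⟩ : S.plus.carrier)⁆ = 1 :=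
    Subtype.ext (comm_dpow_gammaR S)
  rw [laxPlus, orlovPlus, conj_lie, bare, mul_one, Units.mul_inv]

lemma comm_Lax_M (hn : n ≠ 0) (hL : gammaL n S.t ∈ S.minus.carrier) :
    comm S.D (W.Lax n) (W.M n) = dpow A 0 :=
  W.coe_laxMinus n ▸ congr($(W.lie_laxMinus_orlovMinus hn hL).1)

lemma comm_Lax_Mh (hconstr : pow S.D W.L (2 * n) = pow S.D W.Lh 2)
    (hR : gammaR (S.t 1) S.th ∈ S.plus.carrier) : comm S.D (W.Lax n) W.Mh = dpow A 0 :=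
  W.coe_laxPlus hconstr ▸ congr($(W.lie_laxPlus_orlovPlus hR).1)

variable {W}

lemma B_one (hW : W.IsReduced n) (l : ℕ) :
    W.B n 1 l = ((W.orlovMinus hW.gammaL_mem * W.laxMinus n ^ l : S.minus.carrier) : Op A) -
      (W.orlovPlus hW.gammaR_mem * W.laxPlus ^ l : S.plus.carrier) := by
  have minus_pow : pow S.D (W.Lax n) l = (W.laxMinus n ^ l : S.minus.carrier) := by
    rw [coe_pow, coe_laxMinus]
  have plus_pow : pow S.D (W.Lax n) l = (W.laxPlus ^ l : S.plus.carrier) := by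
    rw [coe_pow, W.coe_laxPlus hW.constraint]
  have pow_one : pow S.D (W.M n - W.Mh) 1 =
      W.orlovMinus hW.gammaL_mem + (-W.orlovPlus hW.gammaR_mem : S.plus.carrier) :=
    (dpow_zero_mul S.D _).trans (sub_eq_add_neg _ _)
  rw [B, pow_one, add_mul_of_summable, sub_eq_add_neg, ← AddSubgroup.coe_neg, ← neg_mul, coe_mul,
    coe_mul, minus_pow]
  · rw [← minus_pow, plus_pow]
  · exact minus_pow ▸ S.minus.summable _ (Subtype.property _) _ (Subtype.property _)
  · exact plus_pow ▸ S.plus.summable _ (Subtype.property _) _ (Subtype.property _)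

lemma splits_B (hW : W.IsReduced n) (hmix : m = 1 ∨ W.MixedProductsDefined n) (l : ℕ) :
    Splits S (W.B n m l) := by
  rcases hmix with rfl | ⟨R, hΛ, hM, hMh, hneg, hpos⟩
  · rw [B_one hW]
    exact .of_sub (Subtype.property _) (Subtype.property _)
  · have mem : W.B n m l ∈ R.carrier :=
      R.mul_mem _ (pow_mem (sub_mem hM hMh) m) _ (pow_mem hΛ l)
    exact ⟨hneg _ mem, hpos _ mem⟩

namespace IsBlockFlow

lemma act_unitΦ (h : W.IsBlockFlow n m l δ) (hB : Splits S (W.B n m l)) :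
    act δ (W.unitΦ : S.minus.carrier) = (-hB.negPart * W.unitΦ : S.minus.carrier) := by
  rw [neg_mul]
  exact h.act_Φ

lemma act_unitΦh (h : W.IsBlockFlow n m l δ) (hB : Splits S (W.B n m l)) :
    act δ (W.unitΦh : S.plus.carrier) = (hB.posPart * W.unitΦh : S.plus.carrier) :=
  h.act_Φh

lemma act_laxMinus (h : W.IsBlockFlow n m l δ) (hB : Splits S (W.B n m l)) :
    act δ (W.laxMinus n) = (⁅-hB.negPart, W.laxMinus n⁆ : S.minus.carrier) :=
  h.isFlow_minus.act_conj _ (h.act_unitΦ hB) (act_dpow δ _)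

lemma act_laxPlus (h : W.IsBlockFlow n m l δ) (hB : Splits S (W.B n m l)) :
    act δ W.laxPlus = (⁅hB.posPart, W.laxPlus⁆ : S.plus.carrier) :=
  h.isFlow_plus.act_conj _ (h.act_unitΦh hB) (act_dpow δ _)

lemma act_orlovMinus (h : W.IsBlockFlow n m l δ) (hB : Splits S (W.B n m l))
    (hL : gammaL n S.t ∈ S.minus.carrier) :
    act δ (W.orlovMinus hL) = (⁅-hB.negPart, W.orlovMinus hL⁆ : S.minus.carrier) := by
  refine h.isFlow_minus.act_conj _ (h.act_unitΦ hB) ?_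
  rw [act_gammaL, gammaL_congr n h.apply_t]
  exact gammaL_zero n

lemma act_orlovPlus (h : W.IsBlockFlow n m l δ) (hB : Splits S (W.B n m l))
    (hR : gammaR (S.t 1) S.th ∈ S.plus.carrier) :
    act δ (W.orlovPlus hR) = (⁅hB.posPart, W.orlovPlus hR⁆ : S.plus.carrier) := by
  refine h.isFlow_plus.act_conj _ (h.act_unitΦh hB) ?_
  rw [act_gammaR, gammaR_congr _ h.apply_th, h.apply_t 1 odd_one]
  exact gammaR_zero

lemma act_Lax (h : W.IsBlockFlow n m l δ) (hB : Splits S (W.B n m l)) :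
    act δ (W.Lax n) = comm S.D (-neg (W.B n m l)) (W.Lax n) :=
  W.coe_laxMinus n ▸ h.act_laxMinus hB

end IsBlockFlow

section TotalEquation

variable {δ₁ δ₂ : Derivation ℚ A A}

/-- This operator lies in both `𝒟⁻` and `𝒟⁺`, which replaces products of `𝓜` with `𝓜̂`. -/
lemma coe_orlovMinus_add_neg_negPart (hW : W.IsReduced n) (hB : Splits S (W.B n 1 l)) :
    ((W.orlovMinus hW.gammaL_mem * W.laxMinus n ^ l + -hB.negPart : S.minus.carrier) : Op A) =
      (W.orlovPlus hW.gammaR_mem * W.laxPlus ^ l + hB.posPart : S.plus.carrier) := by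
  have parts : neg (W.B n 1 l) + pos (W.B n 1 l) =
      (W.orlovMinus hW.gammaL_mem * W.laxMinus n ^ l : S.minus.carrier) -
        (W.orlovPlus hW.gammaR_mem * W.laxPlus ^ l : S.plus.carrier) :=
    (Op.neg_add_pos_self _).trans (B_one hW l)
  rw [AddSubgroup.coe_add, AddSubgroup.coe_add, AddSubgroup.coe_neg, Splits.negPart, Splits.posPart]
  linear_combination -parts

lemma act_sub_act_B_one (hn : n ≠ 0) (hW : W.IsReduced n)
    (h₁ : W.IsBlockFlow n 1 l δ₁) (h₂ : W.IsBlockFlow n 1 k δ₂) :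
    act δ₁ (W.B n 1 k) - act δ₂ (W.B n 1 l) =
      comm S.D (pos (W.B n 1 l)) (pos (W.B n 1 k)) - comm S.D (neg (W.B n 1 l)) (neg (W.B n 1 k)) +
        ((k : ℤ) - l) • W.B n 1 (k + l - 1) := by
  have hB₁ := splits_B (m := 1) hW (.inl rfl) l
  have hB₂ := splits_B (m := 1) hW (.inl rfl) k
  have minus := act_sub_act_mul_pow (W.lie_laxMinus_orlovMinus hn hW.gammaL_mem)
    h₁.isFlow_minus.toIsEvolutionary h₂.isFlow_minus.toIsEvolutionary
    (h₁.act_laxMinus hB₁) (h₁.act_orlovMinus hB₁ hW.gammaL_mem) (h₂.act_laxMinus hB₂)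
    (h₂.act_orlovMinus hB₂ hW.gammaL_mem) l k
  have plus := act_sub_act_mul_pow (W.lie_laxPlus_orlovPlus hW.gammaR_mem)
    h₁.isFlow_plus.toIsEvolutionary h₂.isFlow_plus.toIsEvolutionary
    (h₁.act_laxPlus hB₁) (h₁.act_orlovPlus hB₁ hW.gammaR_mem) (h₂.act_laxPlus hB₂)
    (h₂.act_orlovPlus hB₂ hW.gammaR_mem) l k
  rw [neg_lie, lie_neg, neg_neg, AddSubgroup.coe_add, AddSubgroup.coe_sub, coe_lie, coe_lie,
    coe_orlovMinus_add_neg_negPart hW hB₁, coe_orlovMinus_add_neg_negPart hW hB₂] at minus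
  rw [AddSubgroup.coe_add, AddSubgroup.coe_sub, coe_lie, coe_lie] at plus
  conv_lhs => rw [B_one hW, B_one hW]
  rw [act_sub, act_sub, sub_sub_sub_comm, minus, plus, B_one hW (k + l - 1), smul_sub]
  simp only [AddSubgroup.coe_zsmul, Splits.negPart, Splits.posPart]
  abel

lemma act_sub_act_B_of_mixedProductsDefined (hn : n ≠ 0) (hW : W.IsReduced n)
    (hmix : W.MixedProductsDefined n) (h₁ : W.IsBlockFlow n m l δ₁) (h₂ : W.IsBlockFlow n s k δ₂) :
    act δ₁ (W.B n s k) - act δ₂ (W.B n m l) =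
      comm S.D (pos (W.B n m l)) (pos (W.B n s k)) - comm S.D (neg (W.B n m l)) (neg (W.B n s k)) +
        ((k : ℤ) * m - s * l) • W.B n (m + s - 1) (k + l - 1) := by
  have hB₁ := splits_B (m := m) hW (.inr hmix) l
  have hB₂ := splits_B (m := s) hW (.inr hmix) k
  obtain ⟨R, hΛ, hM, hMh, -, -⟩ := hmix
  let Λ : R.carrier := ⟨W.Lax n, hΛ⟩
  let μ : R.carrier := ⟨W.M n, hM⟩
  let μ' : R.carrier := ⟨W.Mh, hMh⟩
  let b (p q : ℕ) : R.carrier :=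
    ⟨W.B n p q, R.mul_mem _ (pow_mem (sub_mem hM hMh) p) _ (pow_mem hΛ q)⟩
  let bneg (p q : ℕ) : R.carrier := ⟨neg (W.B n p q), R.neg_mem _ (b p q).2⟩
  let bpos (p q : ℕ) : R.carrier := ⟨pos (W.B n p q), R.pos_mem _ (b p q).2⟩
  have b_eq (p q : ℕ) : (μ - μ') ^ p * Λ ^ q = b p q := by
    refine Subtype.ext ?_
    rw [coe_mul, coe_pow, coe_pow]
    rfl
  have b_add_neg_bneg (p q : ℕ) : (μ - μ') ^ p * Λ ^ q + -bneg p q = bpos p q := by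
    rw [b_eq, ← sub_eq_add_neg, sub_eq_iff_eq_add']
    exact Subtype.ext (Op.neg_add_pos_self _).symm
  have total := act_sub_act_pow_mul_pow (Λ := Λ) (μ := μ) (μ' := μ')
    (x₁ := -bneg m l) (x₂ := -bneg s k) (y₁ := bpos m l) (y₂ := bpos s k)
    (Subtype.ext (W.comm_Lax_M hn hW.gammaL_mem))
    (Subtype.ext (W.comm_Lax_Mh hW.constraint hW.gammaR_mem))
    h₁.isFlow_minus.toIsEvolutionary h₂.isFlow_minus.toIsEvolutionary
    (h₁.act_Lax hB₁) (h₁.act_orlovMinus hB₁ hW.gammaL_mem) (h₁.act_orlovPlus hB₁ hW.gammaR_mem)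
    (h₂.act_Lax hB₂) (h₂.act_orlovMinus hB₂ hW.gammaL_mem) (h₂.act_orlovPlus hB₂ hW.gammaR_mem)
    (b_add_neg_bneg m l) (b_add_neg_bneg s k)
  rw [neg_lie, lie_neg, neg_neg, b_eq, b_eq, b_eq] at total
  exact total

lemma act_sub_act_B (hn : n ≠ 0) (hW : W.IsReduced n)
    (hmix : (m = 1 ∧ s = 1) ∨ W.MixedProductsDefined n)
    (h₁ : W.IsBlockFlow n m l δ₁) (h₂ : W.IsBlockFlow n s k δ₂) :
    act δ₁ (W.B n s k) - act δ₂ (W.B n m l) =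
      comm S.D (pos (W.B n m l)) (pos (W.B n s k)) - comm S.D (neg (W.B n m l)) (neg (W.B n s k)) +
        ((k : ℤ) * m - s * l) • W.B n (m + s - 1) (k + l - 1) := by
  rcases hmix with ⟨rfl, rfl⟩ | hmix
  · simpa using act_sub_act_B_one hn hW h₁ h₂
  · exact act_sub_act_B_of_mixedProductsDefined hn hW hmix h₁ h₂

end TotalEquation

section BlockFlows

variable {δ₁ δ₂ δ₃ : Derivation ℚ A A}

lemma zeroCurvature_negPart (hn : n ≠ 0) (hW : W.IsReduced n)
    (hmix : (m = 1 ∧ s = 1) ∨ W.MixedProductsDefined n)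
    (h₁ : W.IsBlockFlow n m l δ₁) (h₂ : W.IsBlockFlow n s k δ₂)
    (hB₁ : Splits S (W.B n m l)) (hB₂ : Splits S (W.B n s k))
    (hB₃ : Splits S (W.B n (m + s - 1) (k + l - 1))) :
    ZeroCurvature S.D δ₁ δ₂ (-hB₁.negPart : S.minus.carrier) (-hB₂.negPart : S.minus.carrier)
      (((k : ℤ) * m - s * l) • -hB₃.negPart : S.minus.carrier) := by
  have projected := ZeroCurvature.neg_of_act_sub_act (act_sub_act_B hn hW hmix h₁ h₂)
  rwa [Op.neg_zsmul, ← smul_neg] at projected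

lemma zeroCurvature_posPart (hn : n ≠ 0) (hW : W.IsReduced n)
    (hmix : (m = 1 ∧ s = 1) ∨ W.MixedProductsDefined n)
    (h₁ : W.IsBlockFlow n m l δ₁) (h₂ : W.IsBlockFlow n s k δ₂)
    (hB₁ : Splits S (W.B n m l)) (hB₂ : Splits S (W.B n s k))
    (hB₃ : Splits S (W.B n (m + s - 1) (k + l - 1))) :
    ZeroCurvature S.D δ₁ δ₂ hB₁.posPart hB₂.posPart
      (((k : ℤ) * m - s * l) • hB₃.posPart : S.plus.carrier) := by
  have projected := ZeroCurvature.pos_of_act_sub_act (act_sub_act_B hn hW hmix h₁ h₂)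
  rwa [Op.pos_zsmul] at projected

end BlockFlows

end Dressing

end DrinfeldSokolov

end

open DrinfeldSokolov in
theorem mainTheorem1_general {A : Type*} [CommRing A] [Algebra ℚ A] [TopologicalSpace A]
    [ContinuousAdd A] [T2Space A] {S : Setting A} {W : Dressing S} {n m l s k : ℕ} (hn : n ≠ 0)
    (hW : W.IsReduced n) (hmix : (m = 1 ∧ s = 1) ∨ W.MixedProductsDefined n)
    {δ₁ δ₂ δ₃ : Derivation ℚ A A} (h₁ : W.IsBlockFlow n m l δ₁) (h₂ : W.IsBlockFlow n s k δ₂)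
    (h₃ : (k : ℤ) * m - s * l ≠ 0 → W.IsBlockFlow n (m + s - 1) (k + l - 1) δ₃) :
    act δ₁ (W.Lax n) = comm S.D (-neg (W.B n m l)) (W.Lax n) ∧
    ∀ X : Op A, X = W.Φ ∨ X = W.Φh ∨ X = W.Lax n →
      act δ₁ (act δ₂ X) - act δ₂ (act δ₁ X) = ((k : ℤ) * m - s * l) • act δ₃ X := by
  have hB₁ : Splits S (W.B n m l) := Dressing.splits_B hW (hmix.imp_left And.left) l
  have hB₂ : Splits S (W.B n s k) := Dressing.splits_B hW (hmix.imp_left And.right) k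
  have hB₃ : Splits S (W.B n (m + s - 1) (k + l - 1)) :=
    Dressing.splits_B hW (hmix.imp_left fun h => by rw [h.1, h.2]) _
  have curvature_minus := Dressing.zeroCurvature_negPart hn hW hmix h₁ h₂ hB₁ hB₂ hB₃
  have curvature_plus := Dressing.zeroCurvature_posPart hn hW hmix h₁ h₂ hB₁ hB₂ hB₃
  refine ⟨h₁.act_Lax hB₁, ?_⟩
  rintro X (rfl | rfl | rfl)
  · exact curvature_minus.act_act_sub_of_act_eq_mul h₁.isFlow_minus h₂.isFlow_minus
      (h₁.act_unitΦ hB₁) (h₂.act_unitΦ hB₂) fun hc => (h₃ hc).act_unitΦ hB₃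
  · exact curvature_plus.act_act_sub_of_act_eq_mul h₁.isFlow_plus h₂.isFlow_plus
      (h₁.act_unitΦh hB₁) (h₂.act_unitΦh hB₂) fun hc => (h₃ hc).act_unitΦh hB₃
  · rw [← W.coe_laxMinus n]
    exact curvature_minus.act_act_sub_of_act_eq_lie h₁.isFlow_minus h₂.isFlow_minus
      (h₁.act_laxMinus hB₁) (h₂.act_laxMinus hB₂) fun hc => (h₃ hc).act_laxMinus hB₃

open DrinfeldSokolov in
theorem mainTheorem1 {A : Type*} [CommRing A] [Algebra ℚ A] [TopologicalSpace A]
    [IsTopologicalRing A] [T2Space A]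
    (S : Setting A) (W : Dressing S) (n : ℕ) (hn : 2 ≤ n) (hW : W.SolvesDS n)
    (m s l k : ℕ) (hm : Odd m) (hs : Odd s)
    (hmix : (m = 1 ∧ s = 1) ∨ W.MixedProductsDefined n)
    (dc : ℕ → ℕ → Derivation ℚ A A)
    (hml : W.IsBlockFlow n m l (dc m l))
    (hsk : W.IsBlockFlow n s k (dc s k))
    (hsum : 1 ≤ k + l → W.IsBlockFlow n (m + s - 1) (k + l - 1) (dc (m + s - 1) (k + l - 1))) :
    act (dc m l) (W.Lax n) = comm S.D (-neg (W.B n m l)) (W.Lax n) ∧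
    ∀ X : Op A, X = W.Φ ∨ X = W.Φh ∨ X = W.Lax n →
      act (dc m l) (act (dc s k) X) - act (dc s k) (act (dc m l) X) =
        ((k : ℤ) * m - s * l) • act (dc (m + s - 1) (k + l - 1)) X := by
  exact mainTheorem1_general (by omega) ⟨hW.constraint, hW.gammaL_mem, hW.gammaR_mem⟩ hmix hml hsk
    fun h => hsum (Nat.one_le_iff_ne_zero.2 fun h0 => h (by simp [Nat.add_eq_zero_iff.1 h0]))
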